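/- Let $n \ge 1$ be an integer. A triadic partition of the unit cube is a set of open boxes obtained from $\{(0,1)^3\}$ by finitely many steps (possibly none), each of which chooses a box $R=(a_1,b_1)\times(a_2,b_2)\times(a_3,b_3)$ of the current set and a coordinate direction $k\in\{1,2,3\}$ and replaces $R$ by the three open boxes obtained by dividing the interval $(a_k,b_k)$ into three equal open subintervals. Let $C_{3,3}(n)$ be the number of distinct sets of boxes that can be obtained in exactly $s$ steps, where $n = 1+2s$ (so that there is no such set if $n$ is even). Then there are only finitely many triadic partitions of the unit cube into exactly $n$ boxes, and their number is $C_{3,3}(n)$. If $n$ is even, then $C_{3,3}(n)=0$. If $n$ is odd and $m=\frac{n-1}{2}$, then \[ C_{3,3}(n)=\frac1n\sum_{j=0}^{\lfloor m/13\rfloor}\ \sum_{i=0}^{\lfloor (m-13j)/4\rfloor}\binom{3(m-i-4j)}{n-1,\ m-4i-13j,\ i,\ j}(-1)^i\,3^{\,m-3i-13j}, \] where $\binom{N}{k_1,k_2,k_3,k_4}=\frac{N!}{k_1!\,k_2!\,k_3!\,k_4!}$ for $N = k_1+k_2+k_3+k_4$. -/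

import Mathlib

namespace CubePartition

/-- The open `d`-rectangle `(a₁, b₁) × ⋯ × (a_d, b_d)`, as a set of points of `ℝ^d`. -/
def openRect {d : ℕ} (a b : Fin d → ℝ) : Set (Fin d → ℝ) :=
  {x | ∀ k, a k < x k ∧ x k < b k}

/-- The endpoint `c_i(j) = a_i + (j / p) (b_i - a_i)` of the subdivision of the `i`-th interval
into `p` equal parts. -/
noncomputable def cut {d : ℕ} (p : ℕ) (a b : Fin d → ℝ) (i : Fin d) (j : ℕ) : ℝ :=
  a i + (j : ℝ) / (p : ℝ) * (b i - a i)

/-- `H_i(R)` for `R = openRect a b`: the `p` open rectangles obtained by replacing the `i`-th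
interval by `(c_i(j), c_i(j + 1))`, for `j = 0, …, p - 1`. -/
def pieces {d : ℕ} (p : ℕ) (a b : Fin d → ℝ) (i : Fin d) : Set (Set (Fin d → ℝ)) :=
  {B | ∃ j : ℕ, j < p ∧
    B = openRect (Function.update a i (cut p a b i j)) (Function.update b i (cut p a b i (j + 1)))}

/-- `Reachable d p m S`: the set `S` of blocks arises from `{(0,1)^d}` by exactly `m` steps, where
each step chooses a block `R` of the current set and a direction `i`, and replaces `R` by the
members of `H_i(R)`. -/
inductive Reachable (d p : ℕ) : ℕ → Set (Set (Fin d → ℝ)) → Prop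
  | start : Reachable d p 0 {openRect (fun _ => 0) (fun _ => 1)}
  | step {m : ℕ} {S : Set (Set (Fin d → ℝ))} (hS : Reachable d p m S)
      (a b : Fin d → ℝ) (hab : ∀ k, a k < b k) (hR : openRect a b ∈ S) (i : Fin d) :
      Reachable d p (m + 1) ((S \ {openRect a b}) ∪ pieces p a b i)

/-- `S` is a `p`-ary partition of the open unit `d`-cube (obtained by any number of steps). -/
def IsPartition (d p : ℕ) (S : Set (Set (Fin d → ℝ))) : Prop :=
  ∃ m : ℕ, Reachable d p m S

/-- `(d, p, n)`-decompositions (for `p ≥ 2`): the results of `m` steps, with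
`n = 1 + m (p - 1)`. -/
def IsDecomposition (d p n : ℕ) (S : Set (Set (Fin d → ℝ))) : Prop :=
  ∃ m : ℕ, n = 1 + m * (p - 1) ∧ Reachable d p m S

/-- `C_{d,p}(n)`, the number of distinct `(d, p, n)`-decompositions. -/
noncomputable def C (d p n : ℕ) : ℕ :=
  {S : Set (Set (Fin d → ℝ)) | IsDecomposition d p n S}.ncard

end CubePartition

/-! Different sequences of cuts can give the same partition, so the count is of partitions rather
than of recipes. Let `y` be the generating function of partitions by number of boxes. For a set `K`
of directions, a partition that refines the first cut in every direction of `K` amounts to a free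
choice of a partition in each of the `3 ^ |K|` cells of that grid, so these partitions have series
`y ^ 3 ^ |K|` (`gridSeries_eq_pow`). Every partition other than the uncut cube refines the cut in at
least one direction. Inclusion–exclusion over `K` therefore leaves only the uncut cube: `y - 3y³ +
3y⁹ - y²⁷ = X` (`gridSeries_functional_equation`).

Thus `y` is the compositional inverse of `X / φ` with `φ = 1 / (1 - 3X² + 3X⁸ - X²⁶)`. Lagrange
inversion gives `n [Xⁿ] y = [Xⁿ⁻¹] φⁿ`, and expanding the power of `φ` yields the double sum
(`coeff_inverse_pow`).

The counting is done on finite sets of boxes encoded by base-`p` addresses; `reachable_iff`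
identifies these with the geometric sets of open boxes. -/

/-! ### Lagrange inversion for formal power series. -/

namespace PowerSeries

variable {K : Type*} [Field K]

/-- A right compositional inverse is a left compositional inverse. -/
theorem subst_eq_X_of_subst_eq_X {f y : K⟦X⟧} (hf : f.constantCoeff = 0)
    (hf1 : IsUnit (f.coeff 1)) (hy : y.constantCoeff = 0) (h : f.subst y = X) :
    y.subst f = X := by
  have hf' : HasSubst f := HasSubst.of_constantCoeff_zero' hf
  have hy' : HasSubst y := HasSubst.of_constantCoeff_zero' hy
  have hl : (f.substInvOfIsUnit hf1).subst f = X := subst_substInvOfIsUnit_left f hf hf1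
  have : y = f.substInvOfIsUnit hf1 := by
    have h2 := subst_comp_subst_apply hf' hy' (f.substInvOfIsUnit hf1)
    rw [hl, h, subst_X hy', X_subst] at h2
    exact h2
  rw [this, hl]

variable [CharZero K]

/-- With `f = X * g = X / φ`, this coefficient is the residue of `f' / f ^ (r + 1)`. For `r > 0`
that is the derivative of `-1 / (r f ^ r)` and has no residue; for `r = 0` it is a logarithmic
derivative. The proof avoids Laurent series, and characteristic zero is needed to divide by `r`. -/
theorem coeff_pow_succ_mul_derivative_X_mul {g φ : K⟦X⟧} (h : g * φ = 1) (r : ℕ) :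
    coeff r (φ ^ (r + 1) * d⁄dX K (X * g)) = if r = 0 then 1 else 0 := by
  have hd : d⁄dX K (X * g) = g + X * d⁄dX K g := by
    rw [Derivation.leibniz]
    simp only [derivative_X, smul_eq_mul]
    ring
  have h' : g * d⁄dX K φ + φ * d⁄dX K g = 0 := by
    have := congrArg (d⁄dX K) h
    rw [Derivation.leibniz] at this
    simpa using this
  rw [hd]
  cases r with
  | zero =>
    have h0 := congrArg constantCoeff h
    rw [map_mul, map_one] at h0
    simp [mul_comm, h0]
  | succ s =>
    rw [if_neg (Nat.succ_ne_zero s)]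
    have h1 : φ ^ (s + 1 + 1) * (g + X * d⁄dX K g) =
        φ ^ (s + 1) - X * (φ ^ s * d⁄dX K φ) := by
      linear_combination (φ ^ (s + 1) - X * φ ^ s * d⁄dX K φ) * h + X * φ ^ (s + 1) * h'
    have h2 : ((s + 1 : ℕ) : K⟦X⟧) * (φ ^ s * d⁄dX K φ) = d⁄dX K (φ ^ (s + 1)) := by
      rw [derivative_pow]; simp; ring
    have h3 : ((s + 1 : ℕ) : K) * coeff s (φ ^ s * d⁄dX K φ) =
        coeff (s + 1) (φ ^ (s + 1)) * (s + 1) := by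
      rw [← coeff_derivative, ← h2, ← map_natCast (C (R := K)), coeff_C_mul]
    have h4 : ((s + 1 : ℕ) : K) ≠ 0 := Nat.cast_ne_zero.2 (Nat.succ_ne_zero s)
    rw [h1, map_sub, coeff_succ_X_mul, sub_eq_zero]
    apply mul_left_cancel₀ h4
    rw [h3]
    push_cast
    ring

/-- **Lagrange inversion**: if `y` is the compositional inverse of `X / φ`, then
`[X ^ n] y = (1 / n) [X ^ (n - 1)] φ ^ n`. -/
theorem succ_mul_coeff_of_subst_eq_X {g φ y : K⟦X⟧} (h : g * φ = 1)
    (hy : y.subst (X * g) = X) (N : ℕ) :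
    ((N + 1 : ℕ) : K) * coeff (N + 1) y = coeff N (φ ^ (N + 1)) := by
  set f := X * g with hfdef
  have hf : HasSubst f := HasSubst.of_constantCoeff_zero' (by simp [hfdef])
  have h1 : (d⁄dX K y).subst f * d⁄dX K f = 1 := by
    rw [← derivative_subst hf, hy, derivative_X]
  have hpow (i : ℕ) : f ^ i * φ ^ i = X ^ i := by
    rw [← mul_pow, hfdef, mul_assoc, h, mul_one]
  -- Only the terms of `y'` of degree at most `N` matter: after substituting `f` and multiplying by
  -- `φ ^ (N + 1)`, the remainder is a multiple of `X ^ (N + 1)`.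
  obtain ⟨r, hr⟩ : X ^ (N + 1) ∣ d⁄dX K y - (trunc (N + 1) (d⁄dX K y) : K⟦X⟧) := by
    rw [X_pow_dvd_iff]
    intro m hm
    rw [map_sub, Polynomial.coeff_coe, coeff_trunc, if_pos hm, sub_self]
  have h2 : (d⁄dX K y).subst f =
      ∑ i ∈ Finset.range (N + 1), C (coeff i (d⁄dX K y)) * f ^ i + f ^ (N + 1) * r.subst f := by
    rw [sub_eq_iff_eq_add'] at hr
    conv_lhs => rw [hr]
    rw [subst_add hf, subst_mul hf, subst_pow hf, subst_X hf, subst_coe hf]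
    congr 1
    rw [trunc_apply, Nat.Ico_zero_eq_range, map_sum]
    refine Finset.sum_congr rfl fun i _ => ?_
    rw [Polynomial.aeval_monomial]
    rfl
  have h3 : φ ^ (N + 1) = ∑ i ∈ Finset.range (N + 1),
      C (coeff i (d⁄dX K y)) * (X ^ i * (φ ^ (N - i + 1) * d⁄dX K f)) +
        X ^ (N + 1) * (r.subst f * d⁄dX K f) := by
    calc φ ^ (N + 1) = φ ^ (N + 1) * ((d⁄dX K y).subst f * d⁄dX K f) := by rw [h1, mul_one]
      _ = _ := by
        rw [h2, add_mul, mul_add, Finset.sum_mul, Finset.mul_sum]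
        congr 1
        · refine Finset.sum_congr rfl fun i hi => ?_
          have : N + 1 = i + (N - i + 1) := by
            have := Finset.mem_range.1 hi
            omega
          conv_lhs => rw [this, pow_add]
          rw [← hpow i]
          ring
        · rw [← hpow (N + 1)]
          ring
  rw [h3, map_add, map_sum, coeff_X_pow_mul', if_neg (by omega), add_zero,
    Finset.sum_eq_single_of_mem N (by simp)]
  · rw [coeff_C_mul, coeff_X_pow_mul', if_pos le_rfl, Nat.sub_self,
      coeff_pow_succ_mul_derivative_X_mul h, if_pos rfl, coeff_derivative]
    push_cast
    ring
  · intro i hi hiN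
    have hi' := Finset.mem_range.1 hi
    rw [coeff_C_mul, coeff_X_pow_mul', if_pos (by omega),
      coeff_pow_succ_mul_derivative_X_mul h, if_neg (by omega), mul_zero]

end PowerSeries

/-! ### Partitions as finite sets of addresses, described by trees. -/

namespace CubePartition

/-- A box of the `p`-ary grid: in each direction, the address of a `p`-adic interval. -/
abbrev Box (d p : ℕ) := Fin d → List (Fin p)

namespace Box

variable {d p : ℕ}

/-- The image of a box under the affine map of the cube onto its `j`-th piece in direction `i`. -/
def prepend (i : Fin d) (j : Fin p) (b : Box d p) : Box d p := Function.update b i (j :: b i)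

/-- The `j`-th piece of a box in direction `i`. -/
def append (i : Fin d) (j : Fin p) (b : Box d p) : Box d p := Function.update b i (b i ++ [j])

/-- The box that corresponds to the whole cube. -/
def root : Box d p := fun _ => []

@[simp] theorem prepend_self (i : Fin d) (j : Fin p) (b : Box d p) :
    prepend i j b i = j :: b i := by simp [prepend]

theorem prepend_of_ne {i k : Fin d} (h : k ≠ i) (j : Fin p) (b : Box d p) :
    prepend i j b k = b k := by simp [prepend, h]

theorem prepend_inj {i : Fin d} {j j' : Fin p} {b b' : Box d p} :
    prepend i j b = prepend i j' b' ↔ j = j' ∧ b = b' := by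
  refine ⟨fun h => ?_, fun h => by rw [h.1, h.2]⟩
  have hi := congrFun h i
  simp only [prepend_self, List.cons.injEq] at hi
  refine ⟨hi.1, funext fun k => ?_⟩
  by_cases hk : k = i
  · rw [hk, hi.2]
  · simpa [prepend_of_ne hk] using congrFun h k

theorem prepend_comm {i k : Fin d} (h : i ≠ k) (j l : Fin p) (b : Box d p) :
    prepend i j (prepend k l b) = prepend k l (prepend i j b) := by
  unfold prepend
  rw [Function.update_of_ne h, Function.update_of_ne h.symm, Function.update_comm h]

theorem append_prepend (i k : Fin d) (j l : Fin p) (b : Box d p) :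
    append i j (prepend k l b) = prepend k l (append i j b) := by
  unfold append prepend
  by_cases h : i = k
  · subst h; simp
  · rw [Function.update_of_ne h, Function.update_of_ne (Ne.symm h), Function.update_comm h]

theorem append_root (i : Fin d) (j : Fin p) :
    append i j (root : Box d p) = prepend i j root := by
  simp [append, prepend, root]

end Box

open Box

variable {d p : ℕ}

/-- The partition of the cube whose restriction to the `j`-th piece in direction `i` is a
rescaled copy of `A j`. -/
def glue (i : Fin d) (A : Fin p → Finset (Box d p)) : Finset (Box d p) :=
  Finset.univ.biUnion fun j => (A j).image (prepend i j)

theorem mem_glue {i : Fin d} {A : Fin p → Finset (Box d p)} {b : Box d p} :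
    b ∈ glue i A ↔ ∃ j, ∃ a ∈ A j, prepend i j a = b := by
  simp [glue]

theorem prepend_mem_glue {i : Fin d} {A : Fin p → Finset (Box d p)} {j : Fin p} {b : Box d p} :
    prepend i j b ∈ glue i A ↔ b ∈ A j := by
  simp only [mem_glue, prepend_inj]
  constructor
  · rintro ⟨j, a, ha, rfl, rfl⟩; exact ha
  · exact fun h => ⟨j, b, h, rfl, rfl⟩

theorem glue_injective (i : Fin d) :
    Function.Injective (glue i : (Fin p → Finset (Box d p)) → Finset (Box d p)) := by
  intro A B h
  ext j b
  rw [← prepend_mem_glue (i := i), h, prepend_mem_glue]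

theorem card_glue (i : Fin d) (A : Fin p → Finset (Box d p)) :
    (glue i A).card = ∑ j, (A j).card := by
  rw [glue, Finset.card_biUnion]
  · exact Finset.sum_congr rfl fun j _ =>
      Finset.card_image_of_injective _ fun a b h => (prepend_inj.1 h).2
  · intro j _ l _ hjl
    rw [Function.onFun, Finset.disjoint_left]
    intro b hb hb'
    obtain ⟨a, -, rfl⟩ := Finset.mem_image.1 hb
    obtain ⟨a', -, h⟩ := Finset.mem_image.1 hb'
    exact hjl (prepend_inj.1 h).1.symm

/-- This is how different trees come to have the same blocks: cuts of a full grid in two directions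
may be made in either order. -/
theorem glue_comm {i k : Fin d} (h : i ≠ k) (A : Fin p → Fin p → Finset (Box d p)) :
    glue i (fun j => glue k fun l => A j l) = glue k (fun l => glue i fun j => A j l) := by
  ext b
  simp only [mem_glue]
  constructor
  · rintro ⟨j, _, ⟨l, a, ha, rfl⟩, rfl⟩
    exact ⟨l, _, ⟨j, a, ha, rfl⟩, (prepend_comm h j l a).symm⟩
  · rintro ⟨l, _, ⟨j, a, ha, rfl⟩, rfl⟩
    exact ⟨j, _, ⟨l, a, ha, rfl⟩, prepend_comm h j l a⟩

/-- Recipes for `p`-ary partitions of the `d`-cube. -/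
inductive SplitTree (d p : ℕ) : Type
  | leaf : SplitTree d p
  | node (i : Fin d) (c : Fin p → SplitTree d p) : SplitTree d p

namespace SplitTree

/-- The number of subdivisions that a recipe prescribes. -/
def numNodes : SplitTree d p → ℕ
  | leaf => 0
  | node _ c => 1 + ∑ j, (c j).numNodes

/-- The blocks of the partition that a recipe describes. -/
def blocks : SplitTree d p → Finset (Box d p)
  | leaf => {root}
  | node i c => glue i fun j => (c j).blocks

theorem card_blocks (hp : 1 ≤ p) (t : SplitTree d p) :
    t.blocks.card = 1 + t.numNodes * (p - 1) := by
  induction t with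
  | leaf => simp [blocks, numNodes]
  | node i c ih =>
    simp only [blocks, numNodes, card_glue, ih, Finset.sum_add_distrib, ← Finset.sum_mul]
    simp only [Finset.sum_const, Finset.card_univ, Fintype.card_fin, smul_eq_mul, mul_one]
    rw [add_mul]
    omega

theorem length_le_numNodes (t : SplitTree d p) :
    ∀ b ∈ t.blocks, ∀ k, (b k).length ≤ t.numNodes := by
  induction t with
  | leaf => simp [blocks, numNodes, root]
  | node i c ih =>
    intro b hb k
    obtain ⟨j, a, ha, rfl⟩ := mem_glue.1 hb
    have h1 := ih j a ha k
    have h2 : (c j).numNodes ≤ ∑ j, (c j).numNodes :=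
      Finset.single_le_sum (f := fun j => (c j).numNodes) (fun _ _ => Nat.zero_le _)
        (Finset.mem_univ j)
    have h3 : (prepend i j a k).length ≤ (a k).length + 1 := by
      by_cases hk : k = i
      · subst hk; simp
      · simp [prepend_of_ne hk]
    simp only [numNodes]
    omega

/-- A partition that refines the subdivision in direction `k` can be obtained by starting with
that subdivision. -/
theorem exists_blocks_eq_glue (k : Fin d) (t : SplitTree d p) (h : ∀ b ∈ t.blocks, b k ≠ []) :
    ∃ c : Fin p → SplitTree d p, t.blocks = glue k fun l => (c l).blocks := by
  induction t with
  | leaf => simp [blocks, root] at h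
  | node i c ih =>
    by_cases hk : i = k
    · subst hk; exact ⟨c, rfl⟩
    -- The root cut leaves coordinate `k` alone, so each child also refines the cut in direction
    -- `k`; the two layers of cuts are then interchanged.
    · have (j : Fin p) : ∃ c' : Fin p → SplitTree d p,
          (c j).blocks = glue k fun l => (c' l).blocks := by
        refine ih j fun b hb => ?_
        have := h (prepend i j b) (prepend_mem_glue.2 hb)
        rwa [prepend_of_ne (Ne.symm hk)] at this
      choose c' hc' using this
      refine ⟨fun l => node i fun j => c' j l, ?_⟩
      simp only [blocks, hc']
      exact glue_comm hk _

end SplitTree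

/-! ### Generating functions and inclusion–exclusion. -/

open SplitTree

/-- The partitions into `n` blocks that refine the subdivisions in all directions of `K`. -/
def gridPartitions (K : Finset (Fin d)) (n : ℕ) : Set (Finset (Box d p)) :=
  {A | (∃ t : SplitTree d p, t.blocks = A) ∧ (∀ k ∈ K, ∀ b ∈ A, b k ≠ []) ∧ A.card = n}

theorem gridPartitions_finite (hp : 2 ≤ p) (K : Finset (Fin d)) (n : ℕ) :
    (gridPartitions K n : Set (Finset (Box d p))).Finite := by
  have hw : {w : List (Fin p) | w.length ≤ n}.Finite := List.finite_length_le _ _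
  have hB : {b : Box d p | ∀ k, (b k).length ≤ n}.Finite := by
    have := Set.Finite.pi' fun _ : Fin d => hw
    exact this
  refine (hB.toFinset.powerset.finite_toSet).subset ?_
  rintro A ⟨⟨t, rfl⟩, -, hn⟩
  simp only [Finset.coe_powerset, Set.mem_preimage, Set.mem_powerset_iff, Set.Finite.coe_toFinset]
  intro b hb k
  have h1 := t.length_le_numNodes b hb k
  have h2 := t.card_blocks (by omega)
  have h3 : t.numNodes * 1 ≤ t.numNodes * (p - 1) := Nat.mul_le_mul_left _ (by omega)
  omega

/-- Restricting to the pieces in a new direction `k` does not affect the conditions for `K`, so the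
pieces may be chosen independently. This makes `gridSeries_insert` a `p`-th power. -/
theorem glue_mem_gridPartitions {K : Finset (Fin d)} {k : Fin d} (hk : k ∉ K) {n : ℕ}
    {A : Fin p → Finset (Box d p)} :
    glue k A ∈ gridPartitions (insert k K) n ↔
      (∀ j, A j ∈ gridPartitions K (A j).card) ∧ ∑ j, (A j).card = n := by
  constructor
  · rintro ⟨⟨t, ht⟩, hK, hn⟩
    refine ⟨fun j => ⟨?_, fun i hi b hb => ?_, rfl⟩, by rw [← hn, card_glue]⟩
    · obtain ⟨c, hc⟩ := t.exists_blocks_eq_glue k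
        (fun b hb => hK k (Finset.mem_insert_self _ _) b (ht ▸ hb))
      exact ⟨c j, congrFun (glue_injective k (hc.symm.trans ht)) j⟩
    · have := hK i (Finset.mem_insert_of_mem hi) (prepend k j b) (prepend_mem_glue.2 hb)
      rwa [prepend_of_ne (by rintro rfl; exact hk hi)] at this
  · rintro ⟨h, hn⟩
    choose c hc using fun j => (h j).1
    refine ⟨⟨node k c, ?_⟩, ?_, by rw [card_glue, hn]⟩
    · simp only [blocks, hc]
    · intro i hi b hb
      obtain ⟨j, a, ha, rfl⟩ := mem_glue.1 hb
      rcases Finset.mem_insert.1 hi with rfl | hi'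
      · simp
      · rw [prepend_of_ne (by rintro rfl; exact hk hi')]
        exact (h j).2.1 i hi' a ha

theorem exists_glue_of_mem_gridPartitions {K : Finset (Fin d)} {k : Fin d} (hk : k ∈ K) {n : ℕ}
    {A : Finset (Box d p)} (hA : A ∈ gridPartitions K n) : ∃ B, glue k B = A := by
  obtain ⟨⟨t, rfl⟩, hK, -⟩ := hA
  obtain ⟨c, hc⟩ := t.exists_blocks_eq_glue k (hK k hk)
  exact ⟨_, hc.symm⟩

open Finset in
theorem ncard_gridPartitions_insert (hp : 2 ≤ p) {K : Finset (Fin d)} {k : Fin d} (hk : k ∉ K)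
    (n : ℕ) :
    (gridPartitions (p := p) (insert k K) n).ncard =
      ∑ l ∈ finsuppAntidiag (univ : Finset (Fin p)) n,
        ∏ j, (gridPartitions (p := p) K (l j)).ncard := by
  classical
  have hQ (K : Finset (Fin d)) (n : ℕ) : (gridPartitions (p := p) K n).ncard =
      (gridPartitions_finite hp K n).toFinset.card := Set.ncard_eq_toFinset_card _ _
  simp only [hQ, ← Fintype.card_piFinset]
  rw [← card_sigma]
  symm
  refine card_bij (fun x _ => glue k x.2) ?_ ?_ ?_
  · rintro ⟨l, A⟩ hx
    simp only [mem_sigma, mem_finsuppAntidiag, Fintype.mem_piFinset,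
      Set.Finite.mem_toFinset] at hx
    rw [Set.Finite.mem_toFinset, glue_mem_gridPartitions hk]
    have h (j) : (A j).card = l j := (hx.2 j).2.2
    refine ⟨fun j => by rw [h]; exact hx.2 j, ?_⟩
    simp only [h]
    exact hx.1.1
  · rintro ⟨l, A⟩ hx ⟨l', A'⟩ hx' h
    simp only [mem_sigma, mem_finsuppAntidiag, Fintype.mem_piFinset,
      Set.Finite.mem_toFinset] at hx hx'
    obtain rfl : A = A' := glue_injective k h
    obtain rfl : l = l' := by
      ext j
      rw [← (hx.2 j).2.2, ← (hx'.2 j).2.2]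
    rfl
  · intro A hA
    rw [Set.Finite.mem_toFinset] at hA
    obtain ⟨B, rfl⟩ := exists_glue_of_mem_gridPartitions (mem_insert_self k K) hA
    rw [glue_mem_gridPartitions hk] at hA
    refine ⟨⟨Finsupp.equivFunOnFinite.symm fun j => (B j).card, B⟩, ?_, rfl⟩
    simp only [mem_sigma, mem_finsuppAntidiag, Fintype.mem_piFinset, Set.Finite.mem_toFinset,
      Finsupp.equivFunOnFinite_symm_apply_apply]
    exact ⟨⟨hA.2, subset_univ _⟩, hA.1⟩

/-- The generating function of the partitions that refine the subdivisions in all directions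
of `K`, by the number of blocks. -/
noncomputable def gridSeries (d p : ℕ) (K : Finset (Fin d)) : PowerSeries ℚ :=
  PowerSeries.mk fun n => ((gridPartitions (p := p) K n).ncard : ℚ)

theorem gridSeries_insert (hp : 2 ≤ p) {K : Finset (Fin d)} {k : Fin d} (hk : k ∉ K) :
    gridSeries d p (insert k K) = gridSeries d p K ^ p := by
  have : gridSeries d p K ^ p = ∏ _j : Fin p, gridSeries d p K := by simp
  ext n
  rw [this, PowerSeries.coeff_prod]
  simp [gridSeries, ncard_gridPartitions_insert hp hk]

theorem gridSeries_eq_pow (hp : 2 ≤ p) (K : Finset (Fin d)) :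
    gridSeries d p K = gridSeries d p ∅ ^ p ^ K.card := by
  induction K using Finset.induction_on with
  | empty => simp
  | insert k K hk ih =>
    rw [gridSeries_insert hp hk, ih, Finset.card_insert_of_notMem hk, pow_succ, pow_mul]

open Finset in
theorem sum_neg_one_pow_mul_gridSeries (hp : 2 ≤ p) :
    ∑ K : Finset (Fin d), (-1) ^ K.card * gridSeries d p K = PowerSeries.X := by
  classical
  ext n
  set Q := (gridPartitions_finite (p := p) hp (∅ : Finset (Fin d)) n).toFinset with hQ
  -- `S A` collects the directions whose first cut `A` refines. The signed sum over `K ⊆ S A`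
  -- vanishes unless `S A` is empty, and the direction at the root of any tree for `A` lies in `S
  -- A`.
  let S (A : Finset (Box d p)) : Finset (Fin d) := {k | ∀ b ∈ A, b k ≠ []}
  have h1 (K : Finset (Fin d)) : PowerSeries.coeff n ((-1) ^ K.card * gridSeries d p K) =
      ∑ A ∈ Q, if K ⊆ S A then ((-1) ^ K.card : ℚ) else 0 := by
    have : ((-1) ^ K.card : PowerSeries ℚ) = PowerSeries.C ((-1) ^ K.card) := by simp
    rw [this, PowerSeries.coeff_C_mul, gridSeries, PowerSeries.coeff_mk, ← sum_filter, sum_const,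
      nsmul_eq_mul, mul_comm, Set.ncard_eq_toFinset_card _ (gridPartitions_finite hp K n)]
    congr 3
    ext A
    simp only [hQ, Set.Finite.mem_toFinset, mem_filter, gridPartitions, Set.mem_ofPred_eq, S,
      subset_iff, mem_univ, true_and, notMem_empty, false_imp_iff, implies_true]
    tauto
  have h2 (A : Finset (Box d p)) :
      ∑ K : Finset (Fin d), (if K ⊆ S A then ((-1) ^ K.card : ℚ) else 0) =
        if S A = ∅ then 1 else 0 := by
    rw [← sum_filter]
    have : (univ.filter fun K => K ⊆ S A) = (S A).powerset := by ext; simp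
    rw [this]
    exact_mod_cast sum_powerset_neg_one_pow_card (x := S A)
  have h3 : Q.filter (fun A => S A = ∅) = if n = 1 then {{root}} else ∅ := by
    ext A
    simp only [hQ, Set.Finite.mem_toFinset, mem_filter, gridPartitions, Set.mem_ofPred_eq,
      notMem_empty, false_imp_iff, implies_true, true_and]
    constructor
    · rintro ⟨⟨⟨t, rfl⟩, rfl⟩, h⟩
      cases t with
      | leaf => simp [blocks]
      | node i c =>
        exfalso
        have : i ∈ S (node i c).blocks := by
          simp only [S, mem_filter, mem_univ, true_and, blocks]
          intro b hb
          obtain ⟨j, a, ha, rfl⟩ := mem_glue.1 hb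
          simp
        simp [h] at this
    · split_ifs with hn
      · intro h
        rw [mem_singleton] at h
        subst h hn
        refine ⟨⟨⟨leaf, rfl⟩, by simp⟩, ?_⟩
        simp [S, root]
      · simp
  rw [map_sum]
  simp only [h1]
  rw [sum_comm]
  simp only [h2]
  rw [← sum_filter, h3, PowerSeries.coeff_X]
  split_ifs <;> simp

open Finset in
/-- The functional equation of the generating function of all `p`-ary partitions. -/
theorem gridSeries_functional_equation (d : ℕ) (hp : 2 ≤ p) :
    ∑ m ∈ range (d + 1), (d.choose m : PowerSeries ℚ) * ((-1) ^ m * gridSeries d p ∅ ^ p ^ m) =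
      PowerSeries.X := by
  have h := sum_powerset_apply_card (fun m => (-1) ^ m * gridSeries d p ∅ ^ p ^ m)
    (x := (univ : Finset (Fin d)))
  rw [← sum_neg_one_pow_mul_gridSeries (d := d) hp]
  simp only [powerset_univ, card_univ, Fintype.card_fin, nsmul_eq_mul] at h
  rw [← h]
  exact sum_congr rfl fun K _ => by rw [gridSeries_eq_pow hp K]

end CubePartition

/-! ### From trees to geometric subdivision steps. -/

namespace CubePartition

open Box SplitTree

variable {d p : ℕ}

/-- The subdivision of the block `b` of `A` in direction `i`. -/
def subdivide (A : Finset (Box d p)) (b : Box d p) (i : Fin d) : Finset (Box d p) :=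
  A.erase b ∪ Finset.univ.image fun j => append i j b

theorem glue_update_subdivide (A : Fin p → Finset (Box d p)) (k : Fin d) (j : Fin p)
    (b : Box d p) (i : Fin d) :
    glue k (Function.update A j (subdivide (A j) b i)) =
      subdivide (glue k A) (prepend k j b) i := by
  ext x
  by_cases hx : ∃ l a, x = prepend k l a
  · obtain ⟨l, a, rfl⟩ := hx
    rw [prepend_mem_glue]
    simp only [subdivide, Finset.mem_union, Finset.mem_erase, prepend_mem_glue, Finset.mem_image,
      Finset.mem_univ, true_and, append_prepend, prepend_inj, ne_eq]
    by_cases hl : l = j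
    · subst hl
      simp
    · have : ¬ j = l := fun h => hl h.symm
      simp [hl, this]
  · push Not at hx
    have h1 (A : Fin p → Finset (Box d p)) : x ∉ glue k A := by
      rw [mem_glue]
      rintro ⟨l, a, -, h⟩
      exact hx l a h.symm
    have h2 : x ∉ Finset.univ.image fun l => append i l (prepend k j b) := by
      rw [Finset.mem_image]
      rintro ⟨l, -, h⟩
      rw [append_prepend] at h
      exact hx _ _ h.symm
    simp [subdivide, h1, h2]

namespace SplitTree

theorem blocks_node_leaf (i : Fin d) :
    (node i fun _ : Fin p => leaf).blocks = subdivide leaf.blocks root i := by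
  ext b
  simp [subdivide, blocks, mem_glue, append_root]

theorem blocks_node_update {c : Fin p → SplitTree d p} {k : Fin d} {j : Fin p}
    {t : SplitTree d p} {b : Box d p} {i : Fin d}
    (h : t.blocks = subdivide (c j).blocks b i) :
    (node k (Function.update c j t)).blocks =
      subdivide (node k c).blocks (prepend k j b) i := by
  simp only [blocks]
  rw [← glue_update_subdivide, ← h]
  congr 1
  ext1 l
  exact Function.apply_update (fun _ => blocks) c j t l

theorem numNodes_node_update {c : Fin p → SplitTree d p} {k : Fin d} {j : Fin p}
    {t : SplitTree d p} (h : t.numNodes = (c j).numNodes + 1) :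
    (node k (Function.update c j t)).numNodes = (node k c).numNodes + 1 := by
  simp only [numNodes]
  rw [← Finset.add_sum_erase _ _ (Finset.mem_univ j),
    ← Finset.add_sum_erase _ (fun l => (c l).numNodes) (Finset.mem_univ j),
    Function.update_self, h]
  have : ∑ l ∈ Finset.univ.erase j, (Function.update c j t l).numNodes =
      ∑ l ∈ Finset.univ.erase j, (c l).numNodes :=
    Finset.sum_congr rfl fun l hl => by rw [Function.update_of_ne (Finset.ne_of_mem_erase hl)]
  omega

theorem exists_subdivide (t : SplitTree d p) :
    ∀ b ∈ t.blocks, ∀ i, ∃ t' : SplitTree d p,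
      t'.numNodes = t.numNodes + 1 ∧ t'.blocks = subdivide t.blocks b i := by
  induction t with
  | leaf =>
    intro b hb i
    obtain rfl : b = root := by simpa [blocks] using hb
    exact ⟨node i fun _ => leaf, by simp [numNodes], blocks_node_leaf i⟩
  | node k c ih =>
    intro b hb i
    obtain ⟨j, a, ha, rfl⟩ := mem_glue.1 hb
    obtain ⟨t', h1, h2⟩ := ih j a ha i
    exact ⟨_, numNodes_node_update h1, blocks_node_update h2⟩

/-- A nontrivial tree has a node whose children are all leaves; pruning it undoes one subdivision
step, which lets trees be realised step by step. -/
theorem eq_leaf_or_exists_eq_subdivide (t : SplitTree d p) :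
    t = leaf ∨ ∃ t' : SplitTree d p, t.numNodes = t'.numNodes + 1 ∧
      ∃ b ∈ t'.blocks, ∃ i, t.blocks = subdivide t'.blocks b i := by
  induction t with
  | leaf => exact Or.inl rfl
  | node k c ih =>
    right
    by_cases hc : ∀ j, c j = leaf
    · obtain rfl : c = fun _ => leaf := funext hc
      exact ⟨leaf, by simp [numNodes], root, by simp [blocks], k, blocks_node_leaf k⟩
    · push Not at hc
      obtain ⟨j, hj⟩ := hc
      obtain ⟨t', h1, b, hb, i, h2⟩ := (ih j).resolve_left hj
      -- Putting `c j` back into the pruned family recovers `c`, so the lemmas on updating a child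
      -- apply.
      have hcc : c = Function.update (Function.update c j t') j (c j) := by simp
      have hj' : Function.update c j t' j = t' := Function.update_self ..
      refine ⟨node k (Function.update c j t'), ?_, prepend k j b, ?_, i, ?_⟩
      · conv_lhs => rw [hcc]
        exact numNodes_node_update (by rw [hj', h1])
      · exact prepend_mem_glue.2 (by rwa [hj'])
      · conv_lhs => rw [hcc]
        exact blocks_node_update (by rw [hj', h2])

end SplitTree

/-- The left endpoint of the `p`-adic interval with a given address. -/
noncomputable def wordLower : List (Fin p) → ℝ
  | [] => 0
  | j :: w => (j + wordLower w) / p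

/-- The right endpoint of the `p`-adic interval with a given address. -/
noncomputable def wordUpper : List (Fin p) → ℝ
  | [] => 1
  | j :: w => (j + wordUpper w) / p

theorem wordLower_append (w : List (Fin p)) (j : Fin p) :
    wordLower (w ++ [j]) = wordLower w + (j : ℕ) / p * (wordUpper w - wordLower w) := by
  induction w with
  | nil => simp [wordLower, wordUpper]
  | cons l w ih => simp only [List.cons_append, wordLower, wordUpper, ih]; ring

theorem wordUpper_append (w : List (Fin p)) (j : Fin p) :
    wordUpper (w ++ [j]) =
      wordLower w + ((j + 1 : ℕ) : ℝ) / p * (wordUpper w - wordLower w) := by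
  induction w with
  | nil => simp [wordLower, wordUpper]
  | cons l w ih => simp only [List.cons_append, wordLower, wordUpper, ih]; ring

theorem wordLower_nonneg (w : List (Fin p)) : 0 ≤ wordLower w := by
  induction w with
  | nil => simp [wordLower]
  | cons l w ih => simp only [wordLower]; positivity

theorem wordUpper_le_one (w : List (Fin p)) : wordUpper w ≤ 1 := by
  induction w with
  | nil => simp [wordUpper]
  | cons l w ih =>
    have h : ((l : ℕ) : ℝ) + 1 ≤ p := by exact_mod_cast l.isLt
    have hp : (0 : ℝ) < p := by linarith [Nat.cast_nonneg (α := ℝ) (l : ℕ)]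
    rw [wordUpper, div_le_one hp]
    linarith

theorem wordLower_lt_wordUpper (w : List (Fin p)) : wordLower w < wordUpper w := by
  induction w with
  | nil => simp [wordLower, wordUpper]
  | cons l w ih =>
    have hp : (0 : ℝ) < p := by exact_mod_cast l.pos
    simp only [wordLower, wordUpper]
    gcongr

theorem wordUpper_cons_sub_lt_one (hp : 2 ≤ p) (l : Fin p) (w : List (Fin p)) :
    wordUpper (l :: w) - wordLower (l :: w) < 1 := by
  have hp' : (2 : ℝ) ≤ p := by exact_mod_cast hp
  have h1 := wordLower_nonneg w
  have h2 := wordUpper_le_one w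
  rw [wordUpper, wordLower, ← sub_div, div_lt_one (by linarith)]
  linarith

/-- A nonempty address has an interval shorter than `1`, which separates it from the empty one.
Otherwise `p` times the left endpoint lies in `[l, l + 1)`, which determines the first letter `l`.
-/
theorem word_ext (hp : 2 ≤ p) : ∀ {w w' : List (Fin p)}, wordLower w = wordLower w' →
    wordUpper w = wordUpper w' → w = w'
  | [], [], _, _ => rfl
  | [], l :: w, h1, h2 => by
    have := wordUpper_cons_sub_lt_one hp l w
    rw [← h1, ← h2] at this
    simp [wordLower, wordUpper] at this
  | l :: w, [], h1, h2 => by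
    have := wordUpper_cons_sub_lt_one hp l w
    rw [h1, h2] at this
    simp [wordLower, wordUpper] at this
  | l :: w, l' :: w', h1, h2 => by
    have hp' : (p : ℝ) ≠ 0 := by positivity
    simp only [wordLower, wordUpper, div_left_inj' hp'] at h1 h2
    have hb (v : List (Fin p)) : 0 ≤ wordLower v ∧ wordLower v < 1 :=
      ⟨wordLower_nonneg v, (wordLower_lt_wordUpper v).trans_le (wordUpper_le_one v)⟩
    have h3 : ((l : ℕ) : ℝ) < (l' : ℕ) + 1 := by linarith [(hb w).1, (hb w').2]
    have h4 : ((l' : ℕ) : ℝ) < (l : ℕ) + 1 := by linarith [(hb w).2, (hb w').1]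
    norm_cast at h3 h4
    obtain rfl : l = l' := Fin.ext (by omega)
    rw [word_ext hp (add_left_cancel h1) (add_left_cancel h2)]

theorem openRect_inj {a b a' b' : Fin d → ℝ} (hab : ∀ k, a k < b k) (hab' : ∀ k, a' k < b' k) :
    openRect a b = openRect a' b' ↔ a = a' ∧ b = b' := by
  refine ⟨fun h => ?_, fun h => by rw [h.1, h.2]⟩
  have key {a b a' b' : Fin d → ℝ} (hab : ∀ k, a k < b k)
      (h : openRect a b ⊆ openRect a' b') (k : Fin d) : a' k ≤ a k ∧ b k ≤ b' k := by
    rw [← Set.Ioo_subset_Ioo_iff (hab k)]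
    intro x hx
    -- All coordinates but the `k`-th are kept at midpoints, which isolates the inclusion of the
    -- `k`-th sides.
    have hmem : Function.update (fun l => (a l + b l) / 2) k x ∈ openRect a b := by
      intro l
      by_cases hl : l = k
      · subst hl; simpa using hx
      · have := hab l
        simp only [Function.update_of_ne hl]
        constructor <;> linarith
    simpa using h hmem k
  have h1 := key hab h.subset
  have h2 := key hab' h.symm.subset
  exact ⟨funext fun k => le_antisymm (h2 k).1 (h1 k).1,
    funext fun k => le_antisymm (h1 k).2 (h2 k).2⟩

namespace Box

/-- The left endpoints of the sides of a box. -/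
noncomputable def lower (b : Box d p) (k : Fin d) : ℝ := wordLower (b k)

/-- The right endpoints of the sides of a box. -/
noncomputable def upper (b : Box d p) (k : Fin d) : ℝ := wordUpper (b k)

/-- The points of a box. -/
def toSet (b : Box d p) : Set (Fin d → ℝ) := openRect b.lower b.upper

theorem lower_lt_upper (b : Box d p) (k : Fin d) : b.lower k < b.upper k :=
  wordLower_lt_wordUpper _

theorem toSet_injective (hp : 2 ≤ p) : Function.Injective (toSet : Box d p → _) := by
  intro b b' h
  obtain ⟨h1, h2⟩ := (openRect_inj b.lower_lt_upper b'.lower_lt_upper).1 h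
  exact funext fun k => word_ext hp (congrFun h1 k) (congrFun h2 k)

theorem toSet_root : (root : Box d p).toSet = openRect (fun _ => 0) (fun _ => 1) := rfl

theorem toSet_append (i : Fin d) (j : Fin p) (b : Box d p) :
    (append i j b).toSet = openRect (Function.update b.lower i (cut p b.lower b.upper i j))
      (Function.update b.upper i (cut p b.lower b.upper i (j + 1))) := by
  unfold toSet
  congr 1 <;> ext k <;> by_cases hk : k = i
  · subst hk
    simp [append, lower, upper, cut, wordLower_append]
  · simp [append, lower, hk]
  · subst hk
    simp [append, lower, upper, cut, wordUpper_append]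
  · simp [append, upper, hk]

theorem pieces_eq_range (i : Fin d) (b : Box d p) :
    pieces p b.lower b.upper i = Set.range fun j : Fin p => (append i j b).toSet := by
  ext B
  simp only [pieces, Set.mem_ofPred_eq, Set.mem_range, toSet_append]
  constructor
  · rintro ⟨j, hj, rfl⟩
    exact ⟨⟨j, hj⟩, rfl⟩
  · rintro ⟨j, rfl⟩
    exact ⟨j, j.isLt, rfl⟩

end Box

theorem image_toSet_subdivide (hp : 2 ≤ p) (A : Finset (Box d p)) (b : Box d p) (i : Fin d) :
    toSet '' (subdivide A b i : Set (Box d p)) =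
      (toSet '' (A : Set (Box d p)) \ {openRect b.lower b.upper}) ∪
        pieces p b.lower b.upper i := by
  rw [subdivide, Finset.coe_union, Set.image_union, Finset.coe_erase,
    Set.image_sdiff (toSet_injective hp), Set.image_singleton, pieces_eq_range]
  congr 1
  ext B
  simp

theorem reachable_iff (hp : 2 ≤ p) {m : ℕ} {S : Set (Set (Fin d → ℝ))} :
    Reachable d p m S ↔
      ∃ t : SplitTree d p, t.numNodes = m ∧ toSet '' (t.blocks : Set (Box d p)) = S := by
  constructor
  · intro h
    induction h with
    | start => exact ⟨leaf, rfl, by simp [blocks, toSet_root]⟩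
    | step hS a b hab hR i ih =>
      obtain ⟨t, rfl, rfl⟩ := ih
      obtain ⟨x, hx, hxR⟩ := hR
      obtain ⟨rfl, rfl⟩ := (openRect_inj x.lower_lt_upper hab).1 hxR
      obtain ⟨t', h1, h2⟩ := t.exists_subdivide x hx i
      exact ⟨t', h1, by rw [h2, image_toSet_subdivide hp]⟩
  · rintro ⟨t, rfl, rfl⟩
    induction hm : t.numNodes generalizing t with
    | zero =>
      rcases t.eq_leaf_or_exists_eq_subdivide with rfl | ⟨t', h, -⟩
      · simpa [blocks, toSet_root] using Reachable.start (d := d) (p := p)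
      · omega
    | succ m ih =>
      rcases t.eq_leaf_or_exists_eq_subdivide with rfl | ⟨t', h, b, hb, i, h2⟩
      · simp [numNodes] at hm
      · rw [h2, image_toSet_subdivide hp]
        exact Reachable.step (ih t' (by omega)) _ _ b.lower_lt_upper ⟨b, hb, rfl⟩ i

theorem setOf_isDecomposition (hp : 2 ≤ p) (n : ℕ) :
    {S | IsDecomposition d p n S} =
      (fun A : Finset (Box d p) => toSet '' (A : Set (Box d p))) '' gridPartitions ∅ n := by
  ext S
  simp only [IsDecomposition, reachable_iff hp, gridPartitions, Set.mem_ofPred_eq, Set.mem_image,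
    Finset.notMem_empty, false_imp_iff, implies_true, true_and]
  constructor
  · rintro ⟨m, rfl, t, rfl, rfl⟩
    exact ⟨_, ⟨⟨t, rfl⟩, t.card_blocks (by omega)⟩, rfl⟩
  · rintro ⟨_, ⟨⟨t, rfl⟩, rfl⟩, rfl⟩
    exact ⟨_, t.card_blocks (by omega), t, rfl, rfl⟩

/-- Each step adds exactly `p - 1` blocks, so the number of blocks determines the number of steps.
-/
theorem setOf_isPartition_encard_eq (hp : 2 ≤ p) (n : ℕ) :
    {S | IsPartition d p S ∧ S.encard = n} = {S | IsDecomposition d p n S} := by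
  ext S
  simp only [IsPartition, IsDecomposition, reachable_iff hp, Set.mem_ofPred_eq]
  have h (t : SplitTree d p) : (toSet '' (t.blocks : Set (Box d p))).encard =
      ((1 + t.numNodes * (p - 1) : ℕ) : ℕ∞) := by
    rw [(toSet_injective hp).encard_image, Set.encard_coe_eq_coe_finsetCard,
      t.card_blocks (by omega)]
  constructor
  · rintro ⟨⟨m, t, rfl, rfl⟩, hn⟩
    rw [h, Nat.cast_inj] at hn
    exact ⟨_, hn.symm, t, rfl, rfl⟩
  · rintro ⟨m, rfl, t, rfl, rfl⟩
    exact ⟨⟨_, t, rfl, rfl⟩, h t⟩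

theorem C_eq_ncard_gridPartitions (hp : 2 ≤ p) (n : ℕ) :
    C d p n = (gridPartitions (d := d) (p := p) ∅ n).ncard := by
  rw [C, setOf_isDecomposition hp]
  exact Set.ncard_image_of_injective _
    ((toSet_injective hp).image_injective.comp Finset.coe_injective)

end CubePartition

/-! ### Expansion of the powers of `φ`. -/

namespace PowerSeries

/-- The expansion of `(1 - w) ^ (-(N + 1))`. -/
theorem coeff_pow_succ_of_one_sub_mul_eq_one {K : Type*} [Field K] {w φ : K⟦X⟧} {e : ℕ}
    (he : X ^ (e + 1) ∣ w) (hφ : (1 - w) * φ = 1) (N m : ℕ) :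
    coeff ((e + 1) * m) (φ ^ (N + 1)) =
      ∑ k ∈ Finset.range (m + 1), ((N + k).choose N : K) * coeff ((e + 1) * m) (w ^ k) := by
  have hw0 : w.constantCoeff = 0 := by
    obtain ⟨v, rfl⟩ := he
    simp
  have hw : HasSubst w := HasSubst.of_constantCoeff_zero' hw0
  have h1 := congrArg (subst w) (mk_add_choose_mul_one_sub_pow_eq_one K N)
  have h1' : (1 : K⟦X⟧).subst w = 1 := by
    rw [← coe_substAlgHom hw, map_one]
  rw [subst_mul hw, subst_pow hw, subst_sub hw, subst_X hw, h1'] at h1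
  have h2 : φ ^ (N + 1) = (mk fun k => ((N + k).choose N : K)).subst w := by
    calc φ ^ (N + 1) = ((mk fun k => ((N + k).choose N : K)).subst w * (1 - w) ^ (N + 1)) *
          φ ^ (N + 1) := by rw [h1, one_mul]
      _ = _ := by rw [mul_assoc, ← mul_pow, hφ, one_pow, mul_one]
  rw [h2, coeff_subst' hw, finsum_eq_sum_of_support_subset (s := Finset.range (m + 1))]
  · simp
  · intro k hk
    rw [Finset.coe_range, Set.mem_Iio]
    by_contra! hmk
    refine hk ?_
    -- For `k > m` the order of `w ^ k` exceeds `(e + 1) * m`, so the sum over `k` stops at `m`.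
    have hdvd : X ^ ((e + 1) * (m + 1)) ∣ w ^ k :=
      (pow_dvd_pow X (Nat.mul_le_mul_left _ hmk)).trans (pow_mul (X : K⟦X⟧) (e + 1) k ▸
        pow_dvd_pow_of_dvd he k)
    have : coeff ((e + 1) * m) (w ^ k) = 0 :=
      X_pow_dvd_iff.1 hdvd _ (by rw [mul_add]; omega)
    simp [this]

end PowerSeries

theorem Nat.choose_mul_multinomial_three (N a b c : ℕ) :
    (N + (a + b + c)).choose N * Nat.multinomial Finset.univ ![a, b, c] =
      Nat.multinomial Finset.univ ![N, a, b, c] := by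
  have h1 : a.factorial * (b.factorial * c.factorial) * Nat.multinomial Finset.univ ![a, b, c] =
      (a + b + c).factorial := by
    simpa [Fin.sum_univ_succ, Fin.prod_univ_succ, add_assoc] using
      Nat.multinomial_spec Finset.univ ![a, b, c]
  have h2 : N.factorial * (a.factorial * (b.factorial * c.factorial)) *
      Nat.multinomial Finset.univ ![N, a, b, c] = (N + (a + b + c)).factorial := by
    simpa [Fin.sum_univ_succ, Fin.prod_univ_succ, add_assoc] using
      Nat.multinomial_spec Finset.univ ![N, a, b, c]
  have h3 : (N + (a + b + c)).choose N * N.factorial * (a + b + c).factorial =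
      (N + (a + b + c)).factorial := by
    rw [Nat.choose_symm_add]
    exact Nat.add_choose_mul_factorial_mul_factorial N (a + b + c)
  have h4 : 0 < N.factorial * (a.factorial * (b.factorial * c.factorial)) := by positivity
  apply Nat.eq_of_mul_eq_mul_left h4
  rw [h2, ← h3, ← h1]
  ring

namespace CubePartition

open PowerSeries

/-- The exponents `2, 8, 26` are `3 ^ k - 1` for `k = 1, 2, 3`. Expanding `w ^ k` by the multinomial
theorem, exponents `κ` contribute to `X ^ (2 * m)` exactly when `m = κ 0 + 4 * κ 1 + 13 * κ 2`. -/
theorem coeff_inverse_pow {φ : ℚ⟦X⟧}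
    (hφ : (1 - (3 * X ^ 2 - 3 * X ^ 8 + X ^ 26)) * φ = 1) (N m : ℕ) :
    coeff (2 * m) (φ ^ (N + 1)) =
      ∑ j ∈ Finset.range (m / 13 + 1), ∑ i ∈ Finset.range ((m - 13 * j) / 4 + 1),
        (Nat.multinomial Finset.univ ![N, m - 4 * i - 13 * j, i, j] : ℚ) *
          (-1) ^ i * 3 ^ (m - 3 * i - 13 * j) := by
  have hw (k : ℕ) : coeff (2 * m) ((3 * X ^ 2 - 3 * X ^ 8 + X ^ 26 : ℚ⟦X⟧) ^ k) =
      ∑ κ ∈ Finset.piAntidiag (Finset.univ : Finset (Fin 3)) k,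
        if m = κ 0 + 4 * κ 1 + 13 * κ 2 then
          (Nat.multinomial Finset.univ κ : ℚ) * (3 ^ κ 0 * (-3) ^ κ 1) else 0 := by
    have h1 : (3 * X ^ 2 - 3 * X ^ 8 + X ^ 26 : ℚ⟦X⟧) =
        ∑ i, (![3 * X ^ 2, -3 * X ^ 8, X ^ 26] : Fin 3 → ℚ⟦X⟧) i := by
      simp [Fin.sum_univ_three]; ring
    rw [h1, Finset.sum_pow_eq_sum_piAntidiag, map_sum]
    refine Finset.sum_congr rfl fun κ _ => ?_
    have h2 : (Nat.multinomial Finset.univ κ : ℚ⟦X⟧) *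
        ∏ i, (![3 * X ^ 2, -3 * X ^ 8, X ^ 26] : Fin 3 → ℚ⟦X⟧) i ^ κ i =
        PowerSeries.C ((Nat.multinomial Finset.univ κ : ℚ) * (3 ^ κ 0 * (-3) ^ κ 1)) *
          X ^ (2 * (κ 0 + 4 * κ 1 + 13 * κ 2)) := by
      have h3 : (PowerSeries.C (3 : ℚ) : ℚ⟦X⟧) = 3 := map_ofNat PowerSeries.C 3
      simp only [Fin.prod_univ_three, Matrix.cons_val_zero, Matrix.cons_val_one, Matrix.cons_val,
        map_mul, map_pow, map_neg, map_natCast, h3]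
      ring
    rw [h2, coeff_C_mul, coeff_X_pow, mul_ite, mul_one, mul_zero]
    simp only [mul_eq_mul_left_iff, OfNat.ofNat_ne_zero, or_false]
  rw [coeff_pow_succ_of_one_sub_mul_eq_one (e := 1) ⟨3 - 3 * X ^ 6 + X ^ 24, by ring⟩ hφ]
  simp only [Nat.reduceAdd, hw, Finset.mul_sum, mul_ite, mul_zero]
  rw [Finset.sum_sigma', Finset.sum_sigma', ← Finset.sum_filter]
  -- Given `i = κ 1` and `j = κ 2`, the weight condition forces `κ 0`, and then `k` is the sum of
  -- the three.
  refine Finset.sum_bij' (fun x _ => ⟨x.2 2, x.2 1⟩)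
    (fun y _ => ⟨m - 4 * y.2 - 13 * y.1 + y.2 + y.1, ![m - 4 * y.2 - 13 * y.1, y.2, y.1]⟩)
    ?_ ?_ ?_ ?_ ?_
  · rintro ⟨k, κ⟩ h
    simp only [Finset.mem_filter, Finset.mem_sigma, Finset.mem_range] at h ⊢
    omega
  · rintro ⟨j, i⟩ h
    simp only [Finset.mem_filter, Finset.mem_sigma, Finset.mem_range, Finset.mem_piAntidiag,
      Fin.sum_univ_three, Matrix.cons_val_zero, Matrix.cons_val_one, Matrix.cons_val] at h ⊢
    refine ⟨⟨by omega, by simp⟩, by omega⟩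
  · rintro ⟨k, κ⟩ h
    simp only [Finset.mem_filter, Finset.mem_sigma, Finset.mem_range, Finset.mem_piAntidiag,
      Fin.sum_univ_three] at h
    obtain ⟨⟨-, rfl, -⟩, h2⟩ := h
    have h3 : m - 4 * κ 1 - 13 * κ 2 = κ 0 := by omega
    simp only [h3]
    congr 1
    ext i
    fin_cases i <;> rfl
  · rintro ⟨j, i⟩ h
    rfl
  · rintro ⟨k, κ⟩ h
    simp only [Finset.mem_filter, Finset.mem_sigma, Finset.mem_range, Finset.mem_piAntidiag,
      Fin.sum_univ_three] at h
    obtain ⟨⟨-, rfl, -⟩, h2⟩ := h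
    have h3 : m - 4 * κ 1 - 13 * κ 2 = κ 0 := by omega
    have h4 : m - 3 * κ 1 - 13 * κ 2 = κ 0 + κ 1 := by omega
    have h5 : κ = ![κ 0, κ 1, κ 2] := by
      ext i
      fin_cases i <;> rfl
    simp only [h3, h4]
    rw [← Nat.choose_mul_multinomial_three, ← h5, pow_add, neg_pow (3 : ℚ)]
    push_cast
    ring

/-! ### The count for the triadic cube. -/

theorem C_even {d p n : ℕ} (hp : Odd p) (hn : Even n) : C d p n = 0 := by
  have : {S | IsDecomposition d p n S} = ∅ := by
    rw [Set.eq_empty_iff_forall_notMem]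
    rintro S ⟨m, rfl, -⟩
    have h : Even (p - 1) := Nat.Odd.sub_odd hp odd_one
    exact (Nat.not_even_iff_odd.2 (odd_one.add_even (h.mul_left m))) hn
  rw [C, this, Set.ncard_empty]

theorem mul_C_three_three (m : ℕ) :
    ((2 * m + 1 : ℕ) : ℚ) * C 3 3 (2 * m + 1) =
      ∑ j ∈ Finset.range (m / 13 + 1), ∑ i ∈ Finset.range ((m - 13 * j) / 4 + 1),
        (Nat.multinomial Finset.univ ![2 * m, m - 4 * i - 13 * j, i, j] : ℚ) *
          (-1) ^ i * 3 ^ (m - 3 * i - 13 * j) := by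
  set y := gridSeries 3 3 ∅ with hy
  set g : ℚ⟦X⟧ := 1 - (3 * X ^ 2 - 3 * X ^ 8 + X ^ 26) with hg
  have hg0 : g.constantCoeff = 1 := by simp [hg]
  have hgφ : g * g⁻¹ = 1 := PowerSeries.mul_inv_cancel g (by simp [hg0])
  -- The constant term counts partitions into `0` blocks, and `0` is even.
  have hy0 : y.constantCoeff = 0 := by
    rw [← coeff_zero_eq_constantCoeff_apply, hy, gridSeries, coeff_mk,
      ← C_eq_ncard_gridPartitions (by norm_num), C_even (by decide) (by decide), Nat.cast_zero]
  have hys : HasSubst y := HasSubst.of_constantCoeff_zero' hy0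
  have hfy : (X * g).subst y = X := by
    refine Eq.trans ?_ (gridSeries_functional_equation 3 (p := 3) (by norm_num))
    rw [← coe_substAlgHom hys]
    simp only [hg, map_mul, map_sub, map_add, map_one, map_pow, map_ofNat, substAlgHom_X hys,
      Finset.sum_range_succ, Finset.sum_range_zero, ← hy]
    norm_num [Nat.choose]
    ring
  have hyf : y.subst (X * g) = X :=
    subst_eq_X_of_subst_eq_X (by simp) (by
      rw [coeff_succ_X_mul, coeff_zero_eq_constantCoeff_apply, hg0]
      exact isUnit_one) hy0 hfy
  rw [← coeff_inverse_pow hgφ, ← succ_mul_coeff_of_subst_eq_X hgφ hyf, hy, gridSeries, coeff_mk,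
    C_eq_ncard_gridPartitions (by norm_num)]

end CubePartition

theorem corollary10 (n : ℕ) (hn : 1 ≤ n) :
    -- the triadic partitions of the unit cube into `n` blocks are finitely many,
    -- and their number is `C_{3,3}(n)`
    {S : Set (Set (Fin 3 → ℝ)) | CubePartition.IsPartition 3 3 S ∧ S.encard = n}.Finite ∧
    {S : Set (Set (Fin 3 → ℝ)) | CubePartition.IsPartition 3 3 S ∧ S.encard = n}.ncard =
      CubePartition.C 3 3 n ∧
    (Even n → CubePartition.C 3 3 n = 0) ∧
    -- the upper entry `3 (m - i - 4 j)` of the multinomial coefficient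
    -- is the sum of the four lower ones
    (∀ m : ℕ, n = 2 * m + 1 →
      (CubePartition.C 3 3 n : ℚ) =
        1 / (n : ℚ) *
          ∑ j ∈ Finset.range (m / 13 + 1), ∑ i ∈ Finset.range ((m - 13 * j) / 4 + 1),
            (Nat.multinomial Finset.univ ![n - 1, m - 4 * i - 13 * j, i, j] : ℚ) *
              (-1) ^ i * 3 ^ (m - 3 * i - 13 * j)) := by
  have h3 : 2 ≤ 3 := by norm_num
  rw [CubePartition.setOf_isPartition_encard_eq h3]
  refine ⟨?_, rfl, CubePartition.C_even (by decide), ?_⟩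
  · rw [CubePartition.setOf_isDecomposition h3]
    exact (CubePartition.gridPartitions_finite h3 ∅ n).image _
  · rintro m rfl
    have h0 : ((2 * m + 1 : ℕ) : ℚ) ≠ 0 := by positivity
    rw [Nat.add_sub_cancel, ← CubePartition.mul_C_three_three, one_div,
      inv_mul_cancel_left₀ h0]
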